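/- Let $H$ be a complex Hilbert space and let $\mathcal{N}$ be a continuous nest of projections on $H$: a totally ordered family of orthogonal projections in $\mathcal{B}(H)$ which contains $0$ and the identity, is a complete sublattice of the lattice of all projections (closed under arbitrary suprema and infima), and satisfies $P=\bigvee\{Q\in\mathcal{N}: Q<P\}$ for every nonzero $P\in\mathcal{N}$. Let $\mathcal{T}(\mathcal{N})=\{T\in\mathcal{B}(H): T(P(H))\subseteq P(H)\text{ for all }P\in\mathcal{N}\}$ be the associated nest algebra, and let $\mathfrak{L}$ be a norm closed Lie ideal of $\mathcal{T}(\mathcal{N})$, that is, a norm closed complex subspace of $\mathcal{T}(\mathcal{N})$ such that $AB-BA\in\mathfrak{L}$ for all $A\in\mathfrak{L}$ and $B\in\mathcal{T}(\mathcal{N})$. Then every finite rank operator $T\in\mathfrak{L}$ can be written as a finite sum (empty if $T=0$) of rank one operators, that is, operators of the form $z\mapsto\langle z,x\rangle y$ with $x,y\in H$ nonzero, each of which lies in $\mathfrak{L}$. -/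

import Mathlib

/-- The (orthogonal) projections in `B(H)`, ordered as in Mathlib by the Loewner order; for
projections `P ≤ Q` means that the range of `P` is contained in the range of `Q`
(see `NestAlgebra.Proj.le_iff_range_le`). -/
abbrev NestAlgebra.Proj (H : Type*) [NormedAddCommGroup H] [InnerProductSpace ℂ H]
    [CompleteSpace H] : Type _ :=
  {P : H →L[ℂ] H // IsStarProjection P}

namespace NestAlgebra

section

variable {H : Type*} [NormedAddCommGroup H] [InnerProductSpace ℂ H] [CompleteSpace H]

/-- The order of `Proj H` is inclusion of ranges. -/
theorem Proj.le_iff_range_le (P Q : Proj H) :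
    P ≤ Q ↔ P.1.range ≤ Q.1.range := by
  rw [← Subtype.coe_le_coe, ← ContinuousLinearMap.coe_le_coe_iff]
  exact LinearMap.IsSymmetricProjection.le_iff_range_le_range
    (ContinuousLinearMap.isStarProjection_iff_isSymmetricProjection.mp P.2)
    (ContinuousLinearMap.isStarProjection_iff_isSymmetricProjection.mp Q.2)

/-- The zero projection. -/
def Proj.zero : Proj H := ⟨0, .zero _⟩

/-- The identity projection. -/
def Proj.one : Proj H := ⟨1, .one _⟩

/-- A nest: a totally ordered family of projections containing `0` and the identity. -/
def IsNest (N : Set (Proj H)) : Prop :=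
  IsChain (· ≤ ·) N ∧ Proj.zero ∈ N ∧ Proj.one ∈ N

/-- A complete nest: a nest which is a complete sublattice of the lattice of all projections, that
is, it contains the supremum and the infimum, formed among all projections of `B(H)`, of each of
its subsets. -/
def IsCompleteNest (N : Set (Proj H)) : Prop :=
  IsNest N ∧ ∀ S ⊆ N, (∃ P ∈ N, IsLUB S P) ∧ (∃ P ∈ N, IsGLB S P)

/-- A continuous nest: a complete nest in which `P₋ = P` for all `P`, where
`P₋ = ⋁ {Q ∈ N | Q < P}` for `P ≠ 0` and `P₋ = 0` for `P = 0`. (At `P = 0` the condition below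
holds automatically, `0` being the supremum of the empty set.) -/
def IsContinuousNest (N : Set (Proj H)) : Prop :=
  IsCompleteNest N ∧ ∀ P ∈ N, IsLUB {Q | Q ∈ N ∧ Q < P} P

/-- The nest algebra `T(N)`: all bounded operators leaving invariant the range of each projection
of `N`. -/
def nestAlgebra (N : Set (Proj H)) : Subalgebra ℂ (H →L[ℂ] H) where
  carrier := {T | ∀ P ∈ N, ∀ x ∈ P.1.range, T x ∈ P.1.range}
  mul_mem' hS hT P hP x hx := hS P hP _ (hT P hP x hx)
  add_mem' hS hT P hP x hx := add_mem (hS P hP x hx) (hT P hP x hx)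
  algebraMap_mem' c P _ x hx := by
    simpa [Algebra.algebraMap_eq_smul_one] using P.1.range.smul_mem c hx

/-- A Lie ideal of the nest algebra `T(N)`: a complex subspace `L` of `T(N)` such that
`[A, B] = A B - B A` lies in `L` for all `A` in `L` and `B` in `T(N)`. -/
def IsLieIdeal (N : Set (Proj H)) (L : Submodule ℂ (H →L[ℂ] H)) : Prop :=
  (∀ A ∈ L, A ∈ nestAlgebra N) ∧ ∀ A ∈ L, ∀ B ∈ nestAlgebra N, A * B - B * A ∈ L

/-- A finite rank operator: a bounded operator with finite-dimensional range. -/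
def IsFiniteRank (T : H →L[ℂ] H) : Prop :=
  FiniteDimensional ℂ T.range

/-- A rank one operator: `z ↦ ⟨z, x⟩ y` with `x` and `y` nonzero, where the inner product
`⟨z, x⟩`, linear in `z`, is Mathlib's `inner ℂ x z`. -/
def IsRankOne (T : H →L[ℂ] H) : Prop :=
  ∃ x y : H, x ≠ 0 ∧ y ≠ 0 ∧ T = InnerProductSpace.rankOne ℂ y x

end

end NestAlgebra

namespace NestAlgebra

section

variable {H : Type*} [NormedAddCommGroup H] [InnerProductSpace ℂ H] [CompleteSpace H]

/-! Write `v ⊗ u` for `rankOne ℂ v u`. A closed left `T(N)`-module `J` can be split: for finite rank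
`S ∈ J`, let `P₀` be the least member of the nest whose range contains `ran S`. Multiplying `S` on
the left by suitable `v ⊗ u ∈ T(N)` gives `v ⊗ x ∈ J` for `v` in the range of any smaller `Q`, and
continuity of the nest extends this to `ran P₀`; subtracting one such operator lowers the rank
(`exists_rankOne_reduction`). A Lie ideal is not a left module, but its corners `L ∩ P B(H) (1 - P)`
are (`mul_mem_corner`), and `L` is stable under compression to a corner. Splitting `T` inside `T(N)`
itself writes it as a sum of rank one operators, each in some corner because the nest is continuous.
These need not lie in `L`; peeling off the corners of `T` one by one and splitting each inside `L`
finishes the proof (`sum_mem_rankOneSums`). -/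

theorem Proj.mem_range_iff (P : Proj H) (x : H) : x ∈ P.1.range ↔ P.1 x = x := by
  constructor
  · rintro ⟨z, rfl⟩
    exact congrArg (fun A : H →L[ℂ] H => A z) P.2.isIdempotentElem.eq
  · exact fun h => ⟨x, h⟩

theorem Proj.inner_apply (P : Proj H) (x y : H) : inner ℂ (P.1 x) y = inner ℂ x (P.1 y) := by
  have h := P.2.isSelfAdjoint
  rw [ContinuousLinearMap.isSelfAdjoint_iff'] at h
  conv_lhs => rw [← h]
  exact ContinuousLinearMap.adjoint_inner_left _ _ _

/-- The projection onto a closed subspace. -/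
noncomputable def Proj.ofClosed (M : Submodule ℂ H) (hM : IsClosed (M : Set H)) : Proj H :=
  have : CompleteSpace M := hM.completeSpace_coe
  ⟨M.starProjection, isStarProjection_starProjection⟩

theorem Proj.range_ofClosed (M : Submodule ℂ H) (hM : IsClosed (M : Set H)) :
    (Proj.ofClosed M hM).1.range = M := by
  have : CompleteSpace M := hM.completeSpace_coe
  exact Submodule.range_starProjection M

/-- A closed subspace containing the ranges of a family of projections contains the range of
its supremum. -/
theorem Proj.range_le_of_isLUB {S : Set (Proj H)} {P : Proj H} (hP : IsLUB S P)
    {M : Submodule ℂ H} (hM : IsClosed (M : Set H)) (h : ∀ Q ∈ S, Q.1.range ≤ M) :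
    P.1.range ≤ M := by
  have h1 : P ≤ Proj.ofClosed M hM := hP.2 fun Q hQ => by
    rw [Proj.le_iff_range_le, Proj.range_ofClosed]; exact h Q hQ
  rwa [Proj.le_iff_range_le, Proj.range_ofClosed] at h1

theorem Proj.zero_range : (Proj.zero : Proj H).1.range = ⊥ :=
  LinearMap.range_zero

variable {N : Set (Proj H)}

theorem proj_mem_nestAlgebra (hN : IsNest N) {P : Proj H} (hP : P ∈ N) :
    P.1 ∈ nestAlgebra N := by
  intro Q hQ x hx
  rcases hN.1.total hP hQ with h | h
  · exact (Proj.le_iff_range_le _ _).1 h ⟨x, rfl⟩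
  · have := (Proj.le_iff_range_le _ _).1 h hx
    rw [Proj.mem_range_iff] at this
    rwa [this]

theorem proj_commute (hN : IsNest N) {P Q : Proj H} (hP : P ∈ N) (hQ : Q ∈ N) :
    P.1 * Q.1 = Q.1 * P.1 := by
  have key : ∀ {P Q : Proj H}, P ∈ N → Q ∈ N → P ≤ Q → P.1 * Q.1 = Q.1 * P.1 := by
    intro P Q hP hQ h
    have h1 : Q.1 * P.1 = P.1 := by
      ext z
      exact (Proj.mem_range_iff _ _).1 ((Proj.le_iff_range_le _ _).1 h ⟨z, rfl⟩)
    have h2 := congrArg star h1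
    rw [star_mul, P.2.isSelfAdjoint.star_eq, Q.2.isSelfAdjoint.star_eq] at h2
    rw [h1, h2]
  rcases hN.1.total hP hQ with h | h
  · exact key hP hQ h
  · exact (key hQ hP h).symm

theorem mul_proj_of_mem_nestAlgebra {A : H →L[ℂ] H} (hA : A ∈ nestAlgebra N) {P : Proj H}
    (hP : P ∈ N) : P.1 * A * P.1 = A * P.1 := by
  ext z
  exact (Proj.mem_range_iff _ _).1 (hA P hP _ ⟨z, rfl⟩)

theorem rankOne_mem_nestAlgebra (hN : IsNest N) {P : Proj H} (hP : P ∈ N) {u v : H}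
    (hv : v ∈ P.1.range) (hu : P.1 u = 0) :
    InnerProductSpace.rankOne ℂ v u ∈ nestAlgebra N := by
  intro Q hQ z hz
  rw [InnerProductSpace.rankOne_apply]
  rcases hN.1.total hP hQ with h | h
  · exact Submodule.smul_mem _ _ ((Proj.le_iff_range_le _ _).1 h hv)
  · have := (Proj.mem_range_iff _ _).1 ((Proj.le_iff_range_le _ _).1 h hz)
    rw [← this, ← Proj.inner_apply, hu, inner_zero_left, zero_smul]
    exact zero_mem _

theorem isClosed_nestAlgebra : IsClosed (nestAlgebra N : Set (H →L[ℂ] H)) := by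
  have : (nestAlgebra N : Set (H →L[ℂ] H)) =
      ⋂ P ∈ N, ⋂ x ∈ P.1.range, {A : H →L[ℂ] H | P.1 (A x) = A x} := by
    ext A
    simp only [Set.mem_iInter, Set.mem_ofPred_eq, ← Proj.mem_range_iff]
    rfl
  rw [this]
  refine isClosed_biInter fun P _ => isClosed_biInter fun x _ => isClosed_eq ?_ ?_ <;> fun_prop

/-! ### Splitting finite rank operators in closed left modules -/

/-- A vector outside a finite-dimensional subspace modulo the range of a projection `P` is
separated from it by a vector orthogonal to the range of `P`. -/
theorem exists_separating_vector (P : Proj H) (V : Submodule ℂ H) [FiniteDimensional ℂ V] (y : H)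
    (hy : ∀ v ∈ V, y - v ∉ P.1.range) :
    ∃ u : H, P.1 u = 0 ∧ (∀ v ∈ V, inner ℂ u v = 0) ∧ inner ℂ u y ≠ 0 := by
  set C : H →L[ℂ] H := 1 - P.1
  have hPC : ∀ z, P.1 (C z) = 0 := fun z => by
    have := (Proj.mem_range_iff P _).1 ⟨z, rfl⟩
    simp only [C, sub_apply, one_apply_eq_self, map_sub]
    exact sub_eq_zero.2 this.symm
  let V' : Submodule ℂ H := V.map C.toLinearMap
  -- `u` is the part of `C y` orthogonal to `C V`. Were `u` orthogonal to `y`, it would vanish, so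
  -- `C y = C v₀` and `y - v₀ ∈ ran P`.
  obtain ⟨p, hp, u, hu, hq⟩ := V'.exists_add_mem_mem_orthogonal (C y)
  obtain ⟨v₀, hv₀, rfl⟩ := hp
  have hPu : P.1 u = 0 := by
    have h := congrArg P.1 hq
    rw [map_add, hPC] at h
    have h2 : P.1 (C.toLinearMap v₀) = 0 := hPC v₀
    rw [h2, zero_add] at h
    exact h.symm
  have huC : ∀ z, inner ℂ u (C z) = inner ℂ u z := fun z => by
    simp only [C, sub_apply, one_apply_eq_self, inner_sub_right]
    rw [← Proj.inner_apply, hPu, inner_zero_left, sub_zero]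
  have huV : ∀ v ∈ V, inner ℂ u v = 0 := fun v hv => by
    rw [← huC]
    exact (Submodule.mem_orthogonal' _ _).1 hu _ ⟨v, hv, rfl⟩
  refine ⟨u, hPu, huV, fun h0 => hy v₀ hv₀ ?_⟩
  have h1 : inner ℂ u u = 0 := by
    rw [← huC, hq, inner_add_right] at h0
    have : inner ℂ u (C.toLinearMap v₀) = 0 := (huC v₀).trans (huV v₀ hv₀)
    rwa [this, zero_add] at h0
  rw [inner_self_eq_zero] at h1
  rw [h1, add_zero] at hq
  rw [Proj.mem_range_iff]
  have hq' : y - P.1 y = v₀ - P.1 v₀ := hq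
  rw [map_sub, sub_eq_sub_iff_sub_eq_sub]
  rw [sub_eq_sub_iff_add_eq_add] at hq' ⊢
  rw [add_comm, ← hq', add_comm]

/-- A finite-dimensional subspace `Y ≠ 0` lies in the range of a member `P₀` of the nest such that
the traces on `Y` of the members smaller than `P₀` are all orthogonal to a common vector of `Y`. -/
theorem exists_leading_vector (hN : IsCompleteNest N) (Y : Submodule ℂ H) [FiniteDimensional ℂ Y]
    (hY : Y ≠ ⊥) :
    ∃ P₀ ∈ N, Y ≤ P₀.1.range ∧ ∃ y ∈ Y, y ≠ 0 ∧
      ∀ Q ∈ N, Q < P₀ → ∀ v ∈ Y, v ∈ Q.1.range → inner ℂ y v = 0 := by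
  obtain ⟨P₀, hP₀, hglb⟩ := (hN.2 {P | P ∈ N ∧ Y ≤ P.1.range} fun _ h => h.1).2
  have hYP : Y ≤ P₀.1.range := by
    have hcl : IsClosed (Y : Set H) := Y.closed_of_finiteDimensional
    have := hglb.2 (show Proj.ofClosed Y hcl ∈ _ from fun Q hQ => by
      rw [Proj.le_iff_range_le, Proj.range_ofClosed]; exact hQ.2)
    rwa [Proj.le_iff_range_le, Proj.range_ofClosed] at this
  have hlt : ∀ Q ∈ N, Q < P₀ → ¬ Y ≤ Q.1.range := fun Q hQ h hle =>
    absurd (hglb.1 ⟨hQ, hle⟩) (not_le_of_gt h)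
  have hz : (Proj.zero : Proj H) < P₀ := by
    refine lt_of_le_of_ne ?_ ?_
    · rw [Proj.le_iff_range_le, Proj.zero_range]; exact bot_le
    · rintro rfl
      rw [Proj.zero_range] at hYP
      exact hY (le_bot_iff.1 hYP)
  -- The traces `Y ⊓ ran Q` form a chain of bounded dimension, so one of maximal dimension contains
  -- all the others; it is proper in `Y` by minimality of `P₀`.
  let D : Set ℕ := {d | ∃ Q ∈ N, Q < P₀ ∧ Module.finrank ℂ (Y ⊓ Q.1.range : Submodule ℂ H) = d}
  have hDne : D.Nonempty := ⟨_, Proj.zero, hN.1.2.1, hz, rfl⟩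
  have hDb : BddAbove D := by
    refine ⟨Module.finrank ℂ Y, ?_⟩
    rintro _ ⟨Q, -, -, rfl⟩
    exact Submodule.finrank_mono inf_le_left
  obtain ⟨P₁, hP₁, hP₁lt, hd⟩ := Nat.sSup_mem hDne hDb
  have hmax : ∀ Q ∈ N, Q < P₀ → Y ⊓ Q.1.range ≤ P₁.1.range := by
    intro Q hQ hQlt
    rcases hN.1.1.total hQ hP₁ with h | h
    · exact inf_le_right.trans ((Proj.le_iff_range_le _ _).1 h)
    · have hle : Y ⊓ P₁.1.range ≤ Y ⊓ Q.1.range :=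
        inf_le_inf_left _ ((Proj.le_iff_range_le _ _).1 h)
      have : FiniteDimensional ℂ (Y ⊓ Q.1.range : Submodule ℂ H) :=
        Submodule.finiteDimensional_of_le inf_le_left
      have := Submodule.eq_of_le_of_finrank_le hle (by
        rw [hd]; exact le_csSup hDb ⟨Q, hQ, hQlt, rfl⟩)
      rw [← this]
      exact inf_le_right
  let W : Submodule ℂ H := Y ⊓ P₁.1.range
  have : FiniteDimensional ℂ W := Submodule.finiteDimensional_of_le inf_le_left
  obtain ⟨y₀, hy₀, hy₀P⟩ := SetLike.not_le_iff_exists.1 (hlt P₁ hP₁ hP₁lt)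
  obtain ⟨p, hp, y, hy, hq⟩ := W.exists_add_mem_mem_orthogonal y₀
  refine ⟨P₀, hP₀, hYP, y, ?_, ?_, fun Q hQ hQlt v hv hvQ => ?_⟩
  · have : y = y₀ - p := by rw [hq]; abel
    rw [this]
    exact sub_mem hy₀ hp.1
  · rintro rfl
    rw [add_zero] at hq
    exact hy₀P (hq ▸ hp.2)
  · exact (Submodule.mem_orthogonal' _ _).1 hy v ⟨hv, hmax Q hQ hQlt ⟨hv, hvQ⟩⟩

/-- In a closed left submodule over the algebra of a continuous nest, a nonzero finite rank
operator can be reduced in rank by subtracting a rank one operator of the submodule. -/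
theorem exists_rankOne_reduction (hN : IsContinuousNest N) {J : Submodule ℂ (H →L[ℂ] H)}
    (hJ : IsClosed (J : Set (H →L[ℂ] H))) (hmul : ∀ A ∈ nestAlgebra N, ∀ S ∈ J, A * S ∈ J)
    {S : H →L[ℂ] H} (hS : S ∈ J) (hfin : IsFiniteRank S) (h0 : S ≠ 0) :
    ∃ R ∈ J, IsRankOne R ∧ (S - R).range < S.range := by
  have : FiniteDimensional ℂ S.range := hfin
  have hY : S.range ≠ ⊥ := fun h => h0 (by
    ext z
    have : S z ∈ S.range := ⟨z, rfl⟩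
    rw [h] at this
    simpa using this)
  obtain ⟨P₀, hP₀, hYP, y, hyY, hy0, hyQ⟩ := exists_leading_vector hN.1 S.range hY
  -- Normalised so that `⟨w, y⟩ = 1`: then `S - y ⊗ x`, with `x = S* w`, maps into the hyperplane
  -- `V` of `ran S`, which misses `y`.
  set w : H := ((inner ℂ y y)⁻¹ : ℂ) • y with hw
  have hyy : inner ℂ y y ≠ (0 : ℂ) := inner_self_ne_zero.2 hy0
  have hconj : ∀ v, inner ℂ w v = (inner ℂ y y)⁻¹ * inner ℂ y v := fun v => by
    rw [hw, inner_smul_left, map_inv₀, inner_conj_symm]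
  have hwy : inner ℂ w y = (1 : ℂ) := by rw [hconj, inv_mul_cancel₀ hyy]
  set x : H := ContinuousLinearMap.adjoint S w with hx
  have hxz : ∀ z, inner ℂ x z = inner ℂ w (S z) := fun z =>
    ContinuousLinearMap.adjoint_inner_left _ _ _
  let V : Submodule ℂ H := S.range ⊓ (ℂ ∙ w)ᗮ
  have hV : ∀ v, v ∈ V ↔ v ∈ S.range ∧ inner ℂ w v = 0 := fun v => by
    rw [Submodule.mem_inf, Submodule.mem_orthogonal_singleton_iff_inner_right]
  have : FiniteDimensional ℂ V := Submodule.finiteDimensional_of_le inf_le_left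
  have hres : ∀ z, S z - inner ℂ x z • y ∈ V := fun z => by
    rw [hV, inner_sub_right, inner_smul_right, hwy, hxz, mul_one, sub_self]
    exact ⟨sub_mem ⟨z, rfl⟩ (Submodule.smul_mem _ _ hyY), rfl⟩
  have hyV : y ∉ V := fun h => one_ne_zero (hwy.symm.trans ((hV y).1 h).2)
  have hrange : (S - InnerProductSpace.rankOne ℂ y x).range ≤ V := by
    rintro _ ⟨z, rfl⟩
    exact hres z
  let M : Submodule ℂ H :=
    { carrier := {v | InnerProductSpace.rankOne ℂ v x ∈ J}
      add_mem' := fun {a b} ha hb => by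
        simp only [Set.mem_ofPred_eq, map_add, add_apply] at ha hb ⊢
        exact add_mem ha hb
      zero_mem' := by simp
      smul_mem' := fun c a ha => by
        simp only [Set.mem_ofPred_eq, map_smul, smul_apply] at ha ⊢
        exact J.smul_mem c ha }
  have hM : IsClosed (M : Set H) :=
    hJ.preimage (f := fun v => InnerProductSpace.rankOne ℂ v x) (by fun_prop)
  have hPM : P₀.1.range ≤ M := by
    refine Proj.range_le_of_isLUB (hN.2 P₀ hP₀) hM ?_
    rintro Q ⟨hQ, hQlt⟩ v hv
    -- `y ∉ V + ran Q`: if `y - v ∈ ran Q`, it lies in the trace of `Q` on `ran S`, so it is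
    -- orthogonal to `y` and lies in `V`, forcing `y ∈ V`.
    obtain ⟨u, hQu, huV, huy⟩ := exists_separating_vector Q V y fun v hv hmem => hyV (by
      have hd : y - v ∈ S.range := sub_mem hyY ((hV v).1 hv).1
      have : y - v ∈ V := (hV _).2 ⟨hd, by rw [hconj, hyQ Q hQ hQlt _ hd hmem, mul_zero]⟩
      simpa using add_mem this hv)
    have hmem := hmul _ (rankOne_mem_nestAlgebra hN.1.1 hQ hv hQu) S hS
    have heq : InnerProductSpace.rankOne ℂ v u * S =
        (inner ℂ u y : ℂ) • InnerProductSpace.rankOne ℂ v x := by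
      ext z
      have h := huV _ (hres z)
      rw [inner_sub_right, inner_smul_right, sub_eq_zero] at h
      simp only [mul_apply_eq_comp, smul_apply,
        InnerProductSpace.rankOne_apply, h, smul_smul, mul_comm]
    rw [heq] at hmem
    exact (J.smul_mem_iff huy).1 hmem
  refine ⟨InnerProductSpace.rankOne ℂ y x, hPM (hYP hyY), ⟨x, y, ?_, hy0, rfl⟩,
    lt_of_le_of_ne (hrange.trans inf_le_left) fun h => hyV (hrange (h ▸ hyY))⟩
  intro hx0
  obtain ⟨z, hz⟩ := hyY
  have h1 : inner ℂ x z = (1 : ℂ) := by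
    rw [hxz]
    exact (congrArg (inner ℂ w) hz).trans hwy
  rw [hx0, inner_zero_left] at h1
  exact zero_ne_one h1

/-- Finite sums of rank one operators lying in `J`. -/
abbrev rankOneSums (J : Submodule ℂ (H →L[ℂ] H)) : AddSubmonoid (H →L[ℂ] H) :=
  AddSubmonoid.closure {R | R ∈ J ∧ IsRankOne R}

theorem exists_fin_sum_of_mem_rankOneSums {J : Submodule ℂ (H →L[ℂ] H)} {T : H →L[ℂ] H}
    (hT : T ∈ rankOneSums J) :
    ∃ (n : ℕ) (R : Fin n → (H →L[ℂ] H)), (∀ i, R i ∈ J ∧ IsRankOne (R i)) ∧ T = ∑ i, R i := by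
  obtain ⟨l, hl, rfl⟩ := AddSubmonoid.exists_list_of_mem_closure hT
  exact ⟨l.length, l.get, fun i => hl _ (l.get_mem i), by
    rw [← List.sum_ofFn, List.ofFn_get]⟩

/-- A finite rank operator in a closed left submodule over the algebra of a continuous nest is a
finite sum of rank one operators of the submodule. -/
theorem mem_rankOneSums_of_leftModule (hN : IsContinuousNest N) {J : Submodule ℂ (H →L[ℂ] H)}
    (hJ : IsClosed (J : Set (H →L[ℂ] H))) (hmul : ∀ A ∈ nestAlgebra N, ∀ S ∈ J, A * S ∈ J)
    {S : H →L[ℂ] H} (hS : S ∈ J) (hfin : IsFiniteRank S) : S ∈ rankOneSums J := by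
  induction hn : Module.finrank ℂ S.range using Nat.strong_induction_on generalizing S with
  | _ n ih =>
    subst hn
    by_cases h0 : S = 0
    · rw [h0]; exact zero_mem _
    have : FiniteDimensional ℂ S.range := hfin
    obtain ⟨R, hR, hR1, hlt⟩ := exists_rankOne_reduction hN hJ hmul hS hfin h0
    have h := ih _ (Submodule.finrank_lt_finrank_of_lt hlt) (sub_mem hS hR)
      (Submodule.finiteDimensional_of_le hlt.le) rfl
    rw [← sub_add_cancel S R]
    exact add_mem h (AddSubmonoid.subset_closure ⟨hR, hR1⟩)

/-! ### Corners of a Lie ideal -/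

/-- For `R = y ⊗ x`, take `P` least with `y ∈ ran P`. If `Q < P`, invariance of `ran Q` forces `x ⊥
ran Q`, since `y ∉ ran Q`; continuity then gives `x ⊥ ran P`. -/
theorem exists_corner_of_isRankOne (hN : IsContinuousNest N) {R : H →L[ℂ] H}
    (hR : R ∈ nestAlgebra N) (h1 : IsRankOne R) : ∃ P ∈ N, P.1 * R * (1 - P.1) = R := by
  obtain ⟨x, y, -, hy, rfl⟩ := h1
  have hY : (ℂ ∙ y) ≠ ⊥ := by simpa using hy
  obtain ⟨P, hP, hyP, a, ha, ha0, haQ⟩ := exists_leading_vector hN.1 (ℂ ∙ y) hY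
  have hyQ : ∀ Q ∈ N, Q < P → y ∉ Q.1.range := fun Q hQ hlt hmem =>
    ha0 (inner_self_eq_zero.1 (haQ Q hQ hlt a ha
      ((Submodule.span_singleton_le_iff_mem _ _).2 hmem ha)))
  have hx : P.1.range ≤ (ℂ ∙ x)ᗮ := by
    refine Proj.range_le_of_isLUB (hN.2 P hP) (Submodule.isClosed_orthogonal _) ?_
    rintro Q ⟨hQ, hlt⟩ z hz
    rw [Submodule.mem_orthogonal_singleton_iff_inner_right]
    by_contra h
    have := hR Q hQ z hz
    rw [InnerProductSpace.rankOne_apply] at this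
    exact hyQ Q hQ hlt ((Submodule.smul_mem_iff _ h).1 this)
  have hPy := (Proj.mem_range_iff _ _).1 (hyP (Submodule.mem_span_singleton_self y))
  refine ⟨P, hP, ?_⟩
  ext z
  have hz := (Submodule.mem_orthogonal_singleton_iff_inner_right).1 (hx ⟨z, rfl⟩)
  have hz' : inner ℂ x (P.1 z) = 0 := hz
  simp [inner_sub_right, hPy, hz']

/-- The part of `L` supported in the corner `P B(H) (1 - P)`. -/
def corner (L : Submodule ℂ (H →L[ℂ] H)) (P : Proj H) : Submodule ℂ (H →L[ℂ] H) where
  carrier := {S | S ∈ L ∧ P.1 * S * (1 - P.1) = S}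
  add_mem' := fun ha hb => ⟨add_mem ha.1 hb.1, by rw [mul_add, add_mul, ha.2, hb.2]⟩
  zero_mem' := ⟨zero_mem _, by simp⟩
  smul_mem' := fun c a ha => ⟨L.smul_mem c ha.1, by
    rw [mul_smul_comm, smul_mul_assoc, ha.2]⟩

theorem isClosed_corner {L : Submodule ℂ (H →L[ℂ] H)} (hL : IsClosed (L : Set (H →L[ℂ] H)))
    (P : Proj H) : IsClosed (corner L P : Set (H →L[ℂ] H)) :=
  hL.inter (isClosed_eq (f := fun S : H →L[ℂ] H => P.1 * S * (1 - P.1)) (by fun_prop)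
    continuous_id)

/-- Bracketing with `A P` instead of `A` kills one term: `S A P = S P A P = 0`, so `[S, A P] = -A
S`. -/
theorem mul_mem_corner (hN : IsNest N) {L : Submodule ℂ (H →L[ℂ] H)} (hL : IsLieIdeal N L)
    {P : Proj H} (hP : P ∈ N) {A : H →L[ℂ] H} (hA : A ∈ nestAlgebra N) {S : H →L[ℂ] H}
    (hS : S ∈ corner L P) : A * S ∈ corner L P := by
  obtain ⟨hSL, hSP⟩ := hS
  have hPP : P.1 * P.1 = P.1 := P.2.isIdempotentElem.eq
  have hPS : P.1 * S = S := by
    rw [← hSP, ← mul_assoc, ← mul_assoc, hPP]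
  have hSP' : S * P.1 = 0 := by
    rw [← hSP, mul_assoc, sub_mul, one_mul, hPP, sub_self, mul_zero]
  have hPAP := mul_proj_of_mem_nestAlgebra hA hP
  have hSAP : S * (A * P.1) = 0 := by
    rw [← hPAP, mul_assoc, ← mul_assoc, hSP', zero_mul]
  refine ⟨?_, ?_⟩
  · have h := hL.2 S hSL (A * P.1) (mul_mem hA (proj_mem_nestAlgebra hN hP))
    rw [hSAP, mul_assoc, hPS, zero_sub] at h
    exact (neg_mem_iff (S := Submodule ℂ (H →L[ℂ] H))).1 h
  · calc P.1 * (A * S) * (1 - P.1) = P.1 * (A * S) - P.1 * A * (S * P.1) := by noncomm_ring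
      _ = P.1 * A * P.1 * S := by rw [hSP', mul_zero, sub_zero, mul_assoc (P.1 * A), hPS, mul_assoc]
      _ = A * S := by rw [hPAP, mul_assoc, hPS]

/-- Invariance `P T P = T P` makes the compression a commutator, `P T - T P`. -/
theorem compression_mem_corner (hN : IsNest N) {L : Submodule ℂ (H →L[ℂ] H)}
    (hL : IsLieIdeal N L) {P : Proj H} (hP : P ∈ N) {T : H →L[ℂ] H} (hT : T ∈ L) :
    P.1 * T * (1 - P.1) ∈ corner L P := by
  have hPP : P.1 * P.1 = P.1 := P.2.isIdempotentElem.eq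
  have hPTP := mul_proj_of_mem_nestAlgebra (hL.1 T hT) hP
  refine ⟨?_, ?_⟩
  · have h := hL.2 T hT P.1 (proj_mem_nestAlgebra hN hP)
    rw [← neg_mem_iff, neg_sub] at h
    rwa [mul_sub, mul_one, hPTP]
  · have h2 : (1 - P.1) * (1 - P.1) = 1 - P.1 := by
      rw [mul_sub, mul_one, sub_mul, one_mul, hPP, sub_self, sub_zero]
    rw [mul_assoc, mul_assoc, h2, ← mul_assoc, ← mul_assoc, hPP, mul_assoc]

/-- A finite rank operator of a closed Lie ideal which is a sum of operators supported in corners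
is a finite sum of rank one operators of the ideal. -/
theorem sum_mem_rankOneSums (hN : IsContinuousNest N) {L : Submodule ℂ (H →L[ℂ] H)}
    (hL : IsLieIdeal N L) (hclosed : IsClosed (L : Set (H →L[ℂ] H))) {ι : Type*}
    (P : ι → Proj H) (hP : ∀ i, P i ∈ N) (F : Finset ι) (S : ι → (H →L[ℂ] H))
    (hS : ∀ i, (P i).1 * S i * (1 - (P i).1) = S i) (hSL : ∑ i ∈ F, S i ∈ L)
    (hfin : IsFiniteRank (∑ i ∈ F, S i)) : ∑ i ∈ F, S i ∈ rankOneSums L := by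
  classical
  induction F using Finset.induction_on generalizing S with
  | empty => exact zero_mem _
  | insert j F hj ih =>
    set T := ∑ i ∈ insert j F, S i with hT
    set E := (P j).1
    have hc := compression_mem_corner hN.1.1 hL (hP j) hSL
    have : FiniteDimensional ℂ T.range := hfin
    have hrange : (E * T * (1 - E)).range ≤ T.range.map E.toLinearMap := by
      rintro _ ⟨z, rfl⟩
      exact ⟨T ((1 - E) z), ⟨_, rfl⟩, rfl⟩
    have hcfin : IsFiniteRank (E * T * (1 - E)) := Submodule.finiteDimensional_of_le hrange
    -- Compression to the corner of `E` fixes `S j`, so subtracting it removes that summand; the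
    -- others stay in their own corners because members of the nest commute.
    have hsub : T - E * T * (1 - E) = ∑ i ∈ F, (S i - E * S i * (1 - E)) := by
      rw [hT, Finset.mul_sum, Finset.sum_mul, ← Finset.sum_sub_distrib, Finset.sum_insert hj,
        hS j, sub_self, zero_add]
    have hc1 : E * T * (1 - E) ∈ rankOneSums L := by
      refine AddSubmonoid.closure_mono ?_ (mem_rankOneSums_of_leftModule hN
        (isClosed_corner hclosed (P j))
        (fun A hA S hS => mul_mem_corner hN.1.1 hL (hP j) hA hS) hc hcfin)
      exact fun R hR => ⟨hR.1.1, hR.2⟩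
    rw [← sub_add_cancel T (E * T * (1 - E))]
    refine add_mem ?_ hc1
    rw [hsub]
    refine ih _ (fun i => ?_) (hsub ▸ sub_mem hSL hc.1) (hsub ▸ ?_)
    · have hcomm : (P i).1 * E = E * (P i).1 := proj_commute hN.1.1 (hP i) (hP j)
      have hcomm' : (1 - E) * (1 - (P i).1) = (1 - (P i).1) * (1 - E) := by
        simp only [mul_sub, sub_mul, one_mul, mul_one, hcomm]
        abel
      have : (P i).1 * (E * S i * (1 - E)) * (1 - (P i).1) = E * S i * (1 - E) := by
        calc _ = ((P i).1 * E) * S i * ((1 - E) * (1 - (P i).1)) := by noncomm_ring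
          _ = E * ((P i).1 * S i * (1 - (P i).1)) * (1 - E) := by
            rw [hcomm, hcomm']; noncomm_ring
          _ = _ := by rw [hS i]
      rw [mul_sub _ (S i), sub_mul _ _ (1 - (P i).1), hS i, this]
    · refine Submodule.finiteDimensional_of_le (S₂ := T.range ⊔ T.range.map E.toLinearMap) ?_
      rintro _ ⟨z, rfl⟩
      exact sub_mem (Submodule.mem_sup_left ⟨z, rfl⟩)
        (Submodule.mem_sup_right (hrange ⟨z, rfl⟩))

end

end NestAlgebra

theorem theorem3p5 {H : Type*} [NormedAddCommGroup H] [InnerProductSpace ℂ H] [CompleteSpace H]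
    (N : Set (NestAlgebra.Proj H)) (hN : NestAlgebra.IsContinuousNest N)
    (L : Submodule ℂ (H →L[ℂ] H)) (hL : NestAlgebra.IsLieIdeal N L)
    (hclosed : IsClosed (L : Set (H →L[ℂ] H)))
    (T : H →L[ℂ] H) (hTL : T ∈ L) (hT : NestAlgebra.IsFiniteRank T) :
    ∃ (n : ℕ) (R : Fin n → (H →L[ℂ] H)),
      (∀ i, R i ∈ L ∧ NestAlgebra.IsRankOne (R i)) ∧ T = ∑ i, R i := by
  -- The nest algebra is a closed left module over itself.
  obtain ⟨n, S, hS, rfl⟩ := NestAlgebra.exists_fin_sum_of_mem_rankOneSums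
    (NestAlgebra.mem_rankOneSums_of_leftModule hN
      (J := Subalgebra.toSubmodule (NestAlgebra.nestAlgebra N))
      NestAlgebra.isClosed_nestAlgebra (fun _ hA _ hS => (NestAlgebra.nestAlgebra N).mul_mem hA hS) (hL.1 T hTL) hT)
  choose P hP hSP using fun i => NestAlgebra.exists_corner_of_isRankOne hN (hS i).1 (hS i).2
  exact NestAlgebra.exists_fin_sum_of_mem_rankOneSums
    (NestAlgebra.sum_mem_rankOneSums hN hL hclosed P hP Finset.univ S hSP hTL hT)
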